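/- Let $N\ge 1$ and let $\mathbb{R}^N_\infty=\mathbb{R}^N\cup\{\infty\}$ be the one-point extension of $\mathbb{R}^N$. A sphere in $\mathbb{R}^N_\infty$ is either a Euclidean sphere $\{x\in\mathbb{R}^N : |x-c|=r\}$ with $c\in\mathbb{R}^N$ and $r>0$, or an $(N-1)$-dimensional affine plane of $\mathbb{R}^N$ with the point $\infty$ attached. The inversion in a sphere of the first kind interchanges $c$ and $\infty$ and sends every other $x$ to $c+r^2(x-c)/|x-c|^2$; the inversion in a sphere of the second kind is the Euclidean reflection in the plane, and fixes $\infty$. A Möbius transformation of $\mathbb{R}^N_\infty$ is an element of the group generated by all inversions in spheres. The absolute cross-ratio of four distinct points $a,b,c,d\in\mathbb{R}^N_\infty$ is $$|a,b,c,d|=\frac{|a-b|\,|c-d|}{|a-c|\,|b-d|},$$ where, if one of the points is $\infty$, the two factors containing it are omitted (for example $|\infty,b,c,d|=|c-d|/|b-d|$). Theorem. Let $(p_\alpha)_{\alpha\in\mathcal{A}}$ and $(p'_\alpha)_{\alpha\in\mathcal{A}}$ be two families of points in $\mathbb{R}^N_\infty$ indexed by the same set $\mathcal{A}$ (of any cardinality),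 such that $p_\alpha\neq p_\beta$ and $p'_\alpha\neq p'_\beta$ whenever $\alpha\neq\beta$. Then there is a Möbius transformation $f$ of $\mathbb{R}^N_\infty$ with $f(p_\alpha)=p'_\alpha$ for every $\alpha\in\mathcal{A}$ if and only if $$|p_\alpha,p_\beta,p_\gamma,p_\delta|=|p'_\alpha,p'_\beta,p'_\gamma,p'_\delta|$$ for all ordered $4$-tuples $(\alpha,\beta,\gamma,\delta)$ of distinct indices in $\mathcal{A}$. -/

import Mathlib

open scoped OnePoint

noncomputable section

namespace MobiusSpace

/-- `ℝ^N` with its Euclidean distance. -/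
abbrev E (N : ℕ) : Type := EuclideanSpace ℝ (Fin N)

/-- The one point extension `ℝ^N_∞ = ℝ^N ∪ {∞}`. -/
abbrev Ext (N : ℕ) : Type := OnePoint (E N)

/-- Inversion in the Euclidean sphere with centre `c` and radius `r`, as a map of `ℝ^N_∞`:
it interchanges `c` and `∞`, and sends any other `x` to `c + (r / |x - c|)^2 (x - c)`. -/
def inversionFun {N : ℕ} (c : E N) (r : ℝ) : Ext N → Ext N
  | ∞ => (c : Ext N)
  | OnePoint.some x =>
    open Classical in if x = c then ∞ else ((EuclideanGeometry.inversion c r x : E N) : Ext N)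

theorem inversionFun_involutive {N : ℕ} (c : E N) {r : ℝ} (hr : 0 < r) :
    Function.Involutive (inversionFun c r) := by
  intro x
  induction x using OnePoint.rec with
  | infty => simp [inversionFun]
  | coe x =>
    by_cases h : x = c
    · simp [inversionFun, h]
    · have h' : EuclideanGeometry.inversion c r x ≠ c := by
        rw [Ne, EuclideanGeometry.inversion_eq_center hr.ne']
        exact h
      simp [inversionFun, h, h', EuclideanGeometry.inversion_inversion c hr.ne']

/-- Inversion of `ℝ^N_∞` in the Euclidean sphere with centre `c` and radius `r > 0`. -/
def sphereInversion {N : ℕ} (c : E N) (r : ℝ) (hr : 0 < r) : Equiv.Perm (Ext N) :=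
  (inversionFun_involutive c hr).toPerm

/-- The Euclidean reflection of `ℝ^N` in an affine subspace `s`, extended by `∞ ↦ ∞`. -/
def reflectionFun {N : ℕ} (s : AffineSubspace ℝ (E N)) [Nonempty s] : Ext N → Ext N
  | ∞ => ∞
  | OnePoint.some x => ((EuclideanGeometry.reflection s x : E N) : Ext N)

theorem reflectionFun_involutive {N : ℕ} (s : AffineSubspace ℝ (E N)) [Nonempty s] :
    Function.Involutive (reflectionFun s) := by
  intro x
  induction x using OnePoint.rec with
  | infty => rfl
  | coe x => simp [reflectionFun]

/-- Inversion of `ℝ^N_∞` in `s ∪ {∞}`, for a Euclidean plane `s`. -/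
def planeInversion {N : ℕ} (s : AffineSubspace ℝ (E N)) [Nonempty s] : Equiv.Perm (Ext N) :=
  (reflectionFun_involutive s).toPerm

/-- The inversions in spheres of `ℝ^N_∞`: in Euclidean spheres, and in
`(N-1)`-dimensional Euclidean planes with `∞` attached. -/
def inversions (N : ℕ) : Set (Equiv.Perm (Ext N)) :=
  {f | ∃ (c : E N) (r : ℝ) (hr : 0 < r), f = sphereInversion c r hr} ∪
  {f | ∃ (s : AffineSubspace ℝ (E N)) (_ : Nonempty s),
    Module.finrank ℝ s.direction + 1 = N ∧ f = planeInversion s}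

/-- The group of Möbius transformations of `ℝ^N_∞`, generated by inversions in spheres. -/
def mobiusGroup (N : ℕ) : Subgroup (Equiv.Perm (Ext N)) :=
  Subgroup.closure (inversions N)

/-- The factor `|x - y|` of the absolute cross-ratio; a factor in which `∞` occurs is omitted,
that is, replaced by `1`. -/
def factor {N : ℕ} : Ext N → Ext N → ℝ
  | OnePoint.some x, OnePoint.some y => dist x y
  | _, _ => 1

/-- The absolute cross-ratio `|a,b,c,d| = |a-b||c-d| / (|a-c||b-d|)` of four distinct points of
`ℝ^N_∞`. If one of the points is `∞`, it occurs in one factor of the numerator and in one factor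
of the denominator, and these two factors cancel: `|∞,b,c,d| = |c-d| / |b-d|`, for example. -/
def absCrossRatio {N : ℕ} (a b c d : Ext N) : ℝ :=
  (factor a b * factor c d) / (factor a c * factor b d)

end MobiusSpace

end

open scoped RealInnerProductSpace

namespace MobiusSpace

variable {N : ℕ}

/-! Necessity: each generator multiplies `factor a b` by a product of one weight per point, and such
maps form a group (`HasWeight`). Every point of a cross-ratio occurs once above and once below the
fraction bar, so the weights cancel. Sufficiency: invariance allows both families to be moved so
that one common index sits at `∞` and another at `0`. Cross-ratios through `∞` are quotients of two
distances with a common endpoint, so their equality makes the two finite families similar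
(`exists_dist_eq_mul`). A similarity fixing `0` is a dilation followed by a linear isometry
(`exists_linearIsometryEquiv`), and both are Möbius. -/

theorem factor_coe (x y : E N) : factor (x : Ext N) (y : Ext N) = dist x y := rfl

theorem factor_infty_left (x : Ext N) : factor ∞ x = 1 := rfl

theorem factor_infty_right (x : Ext N) : factor x ∞ = 1 := by
  induction x using OnePoint.rec <;> rfl

theorem factor_comm (x y : Ext N) : factor x y = factor y x := by
  induction x using OnePoint.rec <;> induction y using OnePoint.rec <;>
    simp [factor_coe, factor_infty_left, factor_infty_right, dist_comm]

theorem factor_pos {x y : Ext N} (h : x ≠ y) : 0 < factor x y := by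
  induction x using OnePoint.rec <;> induction y using OnePoint.rec <;>
    simp_all [factor_coe, factor_infty_left, factor_infty_right]

/-- A permutation of `ℝ^N_∞` is conformal with a weight if it distorts the factors `|a - b|` by a
product of positive weights of the two points. -/
def HasWeight (f : Equiv.Perm (Ext N)) : Prop :=
  ∃ w : Ext N → ℝ, (∀ x, 0 < w x) ∧
    ∀ a b, a ≠ b → factor (f a) (f b) = w a * w b * factor a b

theorem HasWeight.mul {f g : Equiv.Perm (Ext N)} (hf : HasWeight f) (hg : HasWeight g) :
    HasWeight (f * g) := by
  obtain ⟨w, hw, h⟩ := hf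
  obtain ⟨u, hu, h'⟩ := hg
  refine ⟨fun x => w (g x) * u x, fun x => mul_pos (hw _) (hu _), fun a b hab => ?_⟩
  rw [Equiv.Perm.mul_apply, Equiv.Perm.mul_apply, h _ _ (g.injective.ne hab), h' _ _ hab]
  ring

theorem HasWeight.inv {f : Equiv.Perm (Ext N)} (hf : HasWeight f) : HasWeight f⁻¹ := by
  obtain ⟨w, hw, h⟩ := hf
  refine ⟨fun x => (w (f⁻¹ x))⁻¹, fun x => inv_pos.2 (hw _), fun a b hab => ?_⟩
  have h1 := h _ _ ((f⁻¹).injective.ne hab)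
  rw [show f (f⁻¹ a) = a from f.apply_symm_apply a,
    show f (f⁻¹ b) = b from f.apply_symm_apply b] at h1
  have ha := (hw (f⁻¹ a)).ne'
  have hb := (hw (f⁻¹ b)).ne'
  rw [h1]
  field_simp

theorem sphereInversion_infty (c : E N) {r : ℝ} (hr : 0 < r) : sphereInversion c r hr ∞ = c := rfl

theorem sphereInversion_center (c : E N) {r : ℝ} (hr : 0 < r) : sphereInversion c r hr c = ∞ := by
  change inversionFun c r c = ∞
  simp [inversionFun]

theorem sphereInversion_coe (c : E N) {r : ℝ} (hr : 0 < r) {x : E N} (hx : x ≠ c) :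
    sphereInversion c r hr x = (EuclideanGeometry.inversion c r x : E N) := by
  change inversionFun c r x = _
  simp [inversionFun, hx]

theorem planeInversion_infty (s : AffineSubspace ℝ (E N)) [Nonempty s] :
    planeInversion s ∞ = ∞ := rfl

theorem planeInversion_coe (s : AffineSubspace ℝ (E N)) [Nonempty s] (x : E N) :
    planeInversion s x = (EuclideanGeometry.reflection s x : E N) := rfl

-- From `|x' - y'| = r² |x - y| / (|x - c| |y - c|)` the weight at a finite `x ≠ c` is `r / |x -
-- c|`. The pairs `(∞, x)` and `(∞, c)` then dictate the values `r` at `∞` and `r⁻¹` at `c`.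
open Classical in
theorem hasWeight_sphereInversion (c : E N) {r : ℝ} (hr : 0 < r) :
    HasWeight (sphereInversion c r hr) := by
  let w : Ext N → ℝ := fun x => if x = ∞ then r else if x = c then r⁻¹ else r / factor x c
  have w1 : w ∞ = r := by simp [w]
  have w2 : w c = r⁻¹ := by simp [w]
  have w3 : ∀ x : E N, x ≠ c → w x = r / dist x c := fun x hx => by simp [w, hx, factor_coe]
  refine ⟨w, fun x => ?_, fun a b hab => ?_⟩
  · simp only [w]
    split_ifs with h1 h2
    · exact hr
    · positivity
    · exact div_pos hr (factor_pos h2)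
  have key : ∀ x : E N, x ≠ c → factor (sphereInversion c r hr ∞) (sphereInversion c r hr x)
      = w ∞ * w x * factor ∞ (x : Ext N) := fun x hx => by
    rw [sphereInversion_infty, sphereInversion_coe c hr hx, factor_coe, dist_comm,
      EuclideanGeometry.dist_inversion_center, w1, w3 x hx, factor_infty_left]
    ring
  have key2 : factor (sphereInversion c r hr ∞) (sphereInversion c r hr c)
      = w ∞ * w c * factor ∞ (c : Ext N) := by
    rw [sphereInversion_center, w1, w2, factor_infty_left, factor_infty_right]
    field_simp
  have key3 : ∀ x : E N, x ≠ c → factor (sphereInversion c r hr c) (sphereInversion c r hr x)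
      = w c * w x * factor (c : Ext N) (x : Ext N) := fun x hx => by
    have := (dist_pos.2 hx).ne'
    rw [sphereInversion_center, w2, w3 x hx, factor_infty_left, factor_coe, dist_comm c x]
    field_simp
  have swap : ∀ {a b : Ext N}, factor (sphereInversion c r hr a) (sphereInversion c r hr b)
      = w a * w b * factor a b → factor (sphereInversion c r hr b) (sphereInversion c r hr a)
      = w b * w a * factor b a := fun {a b} h => by
    rw [factor_comm, h, factor_comm b a, mul_comm (w a)]
  induction a using OnePoint.rec with
  | infty =>
    induction b using OnePoint.rec with
    | infty => exact absurd rfl hab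
    | coe y =>
      by_cases hy : y = c
      · rw [hy]; exact key2
      · exact key y hy
  | coe x =>
    induction b using OnePoint.rec with
    | infty =>
      apply swap
      by_cases hx : x = c
      · rw [hx]; exact key2
      · exact key x hx
    | coe y =>
      by_cases hx : x = c
      · subst hx
        exact key3 y fun h => hab (by rw [h])
      by_cases hy : y = c
      · subst hy
        exact swap (key3 x hx)
      rw [sphereInversion_coe c hr hx, sphereInversion_coe c hr hy, factor_coe,
        EuclideanGeometry.dist_inversion_inversion hx hy, w3 x hx, w3 y hy, factor_coe]
      ring

theorem hasWeight_planeInversion (s : AffineSubspace ℝ (E N)) [Nonempty s] :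
    HasWeight (planeInversion s) := by
  refine ⟨fun _ => 1, fun _ => one_pos, fun a b _ => ?_⟩
  induction a using OnePoint.rec <;> induction b using OnePoint.rec <;>
    simp [planeInversion_infty, planeInversion_coe, factor_infty_left, factor_infty_right,
      factor_coe]

theorem hasWeight_of_mem_mobiusGroup {f : Equiv.Perm (Ext N)} (hf : f ∈ mobiusGroup N) :
    HasWeight f := by
  induction hf using Subgroup.closure_induction with
  | mem f hf =>
    rcases hf with ⟨c, r, hr, rfl⟩ | ⟨s, hs, -, rfl⟩
    · exact hasWeight_sphereInversion c hr
    · exact hasWeight_planeInversion s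
  | one => exact ⟨fun _ => 1, fun _ => one_pos, fun a b _ => by simp⟩
  | mul f g _ _ hf hg => exact hf.mul hg
  | inv f _ hf => exact hf.inv

theorem absCrossRatio_map {f : Equiv.Perm (Ext N)} (hf : f ∈ mobiusGroup N) {a b c d : Ext N}
    (hab : a ≠ b) (hac : a ≠ c) (hbd : b ≠ d) (hcd : c ≠ d) :
    absCrossRatio (f a) (f b) (f c) (f d) = absCrossRatio a b c d := by
  obtain ⟨w, hw, h⟩ := hasWeight_of_mem_mobiusGroup hf
  have ha := (hw a).ne'
  have hb := (hw b).ne'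
  have hc := (hw c).ne'
  have hd := (hw d).ne'
  have h1 := (factor_pos hac).ne'
  have h2 := (factor_pos hbd).ne'
  rw [absCrossRatio, absCrossRatio, h a b hab, h c d hcd, h a c hac, h b d hbd]
  field_simp

/-! ### Similarities as Möbius transformations -/

theorem sphereInversion_mem (c : E N) {r : ℝ} (hr : 0 < r) :
    sphereInversion c r hr ∈ mobiusGroup N :=
  Subgroup.subset_closure (Or.inl ⟨c, r, hr, rfl⟩)

/-- The affine hyperplane through `p` with normal vector `v`. -/
noncomputable abbrev hyperplane (p v : E N) : AffineSubspace ℝ (E N) := AffineSubspace.mk' p (ℝ ∙ v)ᗮ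

theorem planeInversion_hyperplane_mem (p : E N) {v : E N} (hv : v ≠ 0) :
    planeInversion (hyperplane p v) ∈ mobiusGroup N := by
  refine Subgroup.subset_closure (Or.inr ⟨hyperplane p v, inferInstance, ?_, rfl⟩)
  have h := Submodule.finrank_add_finrank_orthogonal (ℝ ∙ v)
  rw [finrank_span_singleton hv, finrank_euclideanSpace_fin] at h
  rw [AffineSubspace.direction_mk', add_comm, h]

theorem exists_mobius_reflection (v : E N) :
    ∃ f ∈ mobiusGroup N, f ∞ = ∞ ∧ ∀ x : E N, f x = ((ℝ ∙ v)ᗮ.reflection x : E N) := by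
  -- For `v = 0` the complement is the whole space, so the reflection is the identity rather than a
  -- generator.
  by_cases hv : v = 0
  · subst hv
    refine ⟨1, one_mem _, rfl, fun x => ?_⟩
    have : (ℝ ∙ (0 : E N))ᗮ.reflection x = x :=
      (Submodule.reflection_eq_self_iff _).2 (by simp)
    rw [this, Equiv.Perm.one_apply]
  · refine ⟨_, planeInversion_hyperplane_mem 0 hv, rfl, fun x => ?_⟩
    rw [planeInversion_coe, EuclideanGeometry.reflection_apply_of_mem _ x
      (AffineSubspace.self_mem_mk' 0 (ℝ ∙ v)ᗮ)]
    simp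

/-- Cartan–Dieudonné: hyperplane reflections generate the orthogonal group. -/
theorem exists_mobius_linearIsometryEquiv (φ : E N ≃ₗᵢ[ℝ] E N) :
    ∃ f ∈ mobiusGroup N, f ∞ = ∞ ∧ ∀ x : E N, f x = (φ x : E N) := by
  have hφ : φ ∈ Subgroup.closure (Set.range fun v : E N => (ℝ ∙ v)ᗮ.reflection) := by
    rw [LinearIsometryEquiv.reflections_generate]
    trivial
  induction hφ using Subgroup.closure_induction with
  | mem φ hφ =>
    obtain ⟨v, rfl⟩ := hφ
    exact exists_mobius_reflection v
  | one => exact ⟨1, one_mem _, rfl, fun x => rfl⟩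
  | mul φ ψ _ _ hφ hψ =>
    obtain ⟨f, hf, hf', hfx⟩ := hφ
    obtain ⟨g, hg, hg', hgx⟩ := hψ
    refine ⟨f * g, mul_mem hf hg, ?_, fun x => ?_⟩
    · rw [Equiv.Perm.mul_apply, hg', hf']
    · rw [Equiv.Perm.mul_apply, hgx, hfx]
      rfl
  | inv φ _ hφ =>
    obtain ⟨f, hf, hf', hfx⟩ := hφ
    refine ⟨f⁻¹, inv_mem hf, ?_, fun x => ?_⟩
    · rw [Equiv.Perm.inv_eq_iff_eq, hf']
    · rw [Equiv.Perm.inv_eq_iff_eq, hfx]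
      exact congrArg _ (φ.apply_symm_apply x).symm

/-- Inverting in concentric spheres of radii `1` and then `√k` scales by the squared quotient of the
radii. -/
theorem exists_mobius_smul {k : ℝ} (hk : 0 < k) :
    ∃ f ∈ mobiusGroup N, f ∞ = ∞ ∧ ∀ x : E N, f x = (k • x : E N) := by
  have hs : 0 < √k := Real.sqrt_pos.2 hk
  refine ⟨sphereInversion 0 (√k) hs * sphereInversion 0 1 one_pos,
    mul_mem (sphereInversion_mem _ _) (sphereInversion_mem _ _), ?_, fun x => ?_⟩
  · rw [Equiv.Perm.mul_apply, sphereInversion_infty, sphereInversion_center]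
  · rw [Equiv.Perm.mul_apply]
    by_cases hx : x = 0
    · rw [hx, sphereInversion_center, sphereInversion_infty, smul_zero]
    · have hx' : EuclideanGeometry.inversion 0 1 x ≠ 0 := by
        rwa [Ne, EuclideanGeometry.inversion_eq_center one_ne_zero]
      rw [sphereInversion_coe _ _ hx, sphereInversion_coe _ _ hx']
      have hn := norm_ne_zero_iff.2 hx
      congr 1
      have hd := EuclideanGeometry.dist_inversion_center (0 : E N) x 1
      rw [EuclideanGeometry.inversion, hd, EuclideanGeometry.inversion]
      simp only [dist_zero_right, vsub_eq_sub, sub_zero, vadd_eq_add, add_zero, smul_smul]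
      congr 1
      rw [div_pow, Real.sq_sqrt hk.le]
      field_simp

theorem exists_mobius_apply_eq_infty (a : Ext N) : ∃ f ∈ mobiusGroup N, f a = ∞ := by
  induction a using OnePoint.rec with
  | infty => exact ⟨1, one_mem _, rfl⟩
  | coe x => exact ⟨_, sphereInversion_mem x one_pos, sphereInversion_center x one_pos⟩

theorem exists_mobius_normalize {a b : Ext N} (hab : a ≠ b) :
    ∃ f ∈ mobiusGroup N, f a = ∞ ∧ f b = (0 : E N) := by
  obtain ⟨f, hf, hfa⟩ := exists_mobius_apply_eq_infty a
  have hfb : f b ≠ ∞ := fun h => hab (f.injective (hfa.trans h.symm))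
  obtain ⟨x, hx⟩ := OnePoint.ne_infty_iff_exists.1 hfb
  by_cases h0 : x = 0
  · exact ⟨f, hf, hfa, by rw [← hx, h0]⟩
  -- The perpendicular bisector of `0` and `x`: reflection in it takes `x` to `0` and keeps `∞`
  -- fixed.
  refine ⟨_, mul_mem (planeInversion_hyperplane_mem ((2⁻¹ : ℝ) • x) h0) hf, ?_, ?_⟩
  · rw [Equiv.Perm.mul_apply, hfa, planeInversion_infty]
  · rw [Equiv.Perm.mul_apply, ← hx, planeInversion_coe]
    have hm : (2⁻¹ : ℝ) • x ∈ (hyperplane ((2⁻¹ : ℝ) • x) x).directionᗮ := by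
      rw [AffineSubspace.direction_mk', Submodule.orthogonal_orthogonal]
      exact Submodule.smul_mem _ _ (Submodule.mem_span_singleton_self x)
    have h := EuclideanGeometry.reflection_orthogonal_vadd
      (AffineSubspace.self_mem_mk' ((2⁻¹ : ℝ) • x) (ℝ ∙ x)ᗮ) hm
    rw [vadd_eq_add, vadd_eq_add, neg_add_cancel, ← add_smul] at h
    rw [show (2⁻¹ : ℝ) + 2⁻¹ = 1 by norm_num, one_smul] at h
    rw [h]

/-! ### Rigidity of families with prescribed distances -/

/-- Families of vectors with the same norms and mutual distances differ by a linear isometry. -/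
theorem exists_linearIsometryEquiv {ι V : Type*} [NormedAddCommGroup V] [InnerProductSpace ℝ V]
    [FiniteDimensional ℝ V] (x y : ι → V) (h0 : ∀ i, ‖x i‖ = ‖y i‖)
    (h : ∀ i j, dist (x i) (x j) = dist (y i) (y j)) :
    ∃ φ : V ≃ₗᵢ[ℝ] V, ∀ i, φ (x i) = y i := by
  have hinner : ∀ i j, ⟪x i, x j⟫ = ⟪y i, y j⟫ := fun i j => by
    rw [real_inner_eq_norm_mul_self_add_norm_mul_self_sub_norm_sub_mul_self_div_two,
      real_inner_eq_norm_mul_self_add_norm_mul_self_sub_norm_sub_mul_self_div_two,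
      ← dist_eq_norm, ← dist_eq_norm, h0, h0, h]
  let X := Finsupp.linearCombination ℝ x
  let Y := Finsupp.linearCombination ℝ y
  have hXY : ∀ c, ‖X c‖ = ‖Y c‖ := fun c => by
    rw [← sq_eq_sq₀ (norm_nonneg _) (norm_nonneg _), ← real_inner_self_eq_norm_sq,
      ← real_inner_self_eq_norm_sq]
    simp only [X, Y, Finsupp.linearCombination_apply, Finsupp.sum, sum_inner, inner_sum,
      real_inner_smul_left, real_inner_smul_right, hinner]
  -- By `hXY`, `Y` vanishes on the kernel of `X`, so `Y ∘ s` does not depend on the section `s` and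
  -- is an isometry from the span of the `x i`. It extends to `V`, where finite dimension gives
  -- surjectivity.
  obtain ⟨s, hs⟩ := X.rangeRestrict.exists_rightInverse_of_surjective X.range_rangeRestrict
  have hs' : ∀ v : LinearMap.range X, X (s v) = v := fun v =>
    congrArg Subtype.val (LinearMap.congr_fun hs v)
  let L : LinearMap.range X →ₗᵢ[ℝ] V :=
    { toLinearMap := Y ∘ₗ s
      norm_map' := fun v => by
        rw [LinearMap.comp_apply, ← hXY, hs', Submodule.coe_norm] }
  refine ⟨L.extend.toLinearIsometryEquiv rfl, fun i => ?_⟩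
  have hi : X (Finsupp.single i 1) = x i := by simp [X]
  have hi' : Y (Finsupp.single i 1) = y i := by simp [Y]
  let v : LinearMap.range X := ⟨x i, _, hi⟩
  have h1 : L.extend (x i) = Y (s v) := L.extend_apply v
  have h2 : ‖Y (s v - Finsupp.single i 1)‖ = 0 := by
    rw [← hXY, map_sub, hs', hi, sub_self, norm_zero]
  rw [norm_eq_zero, map_sub, hi', sub_eq_zero] at h2
  exact h1.trans h2

/-- Equality of the quotients `|c - d| / |b - d|` forces all distances to be proportional. -/
theorem exists_dist_eq_mul {ι V : Type*} [MetricSpace V] (x y : ι → V)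
    (hx : Function.Injective x) (hy : Function.Injective y)
    (h : ∀ b c d, b ≠ c → b ≠ d → c ≠ d →
      dist (x c) (x d) / dist (x b) (x d) = dist (y c) (y d) / dist (y b) (y d)) (o : ι) :
    ∃ k : ℝ, 0 < k ∧ ∀ b c, dist (y b) (y c) = k * dist (x b) (x c) := by
  have px : ∀ {b c}, b ≠ c → 0 < dist (x b) (x c) := fun hbc => dist_pos.2 (hx.ne hbc)
  have py : ∀ {b c}, b ≠ c → 0 < dist (y b) (y c) := fun hbc => dist_pos.2 (hy.ne hbc)
  by_cases hι : ∃ e, e ≠ o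
  swap
  · push Not at hι
    exact ⟨1, one_pos, fun b c => by rw [hι b, hι c, dist_self, dist_self, mul_zero]⟩
  obtain ⟨e, he⟩ := hι
  -- The factor `k` passes between pairs sharing the endpoint `d`. Starting from `(e, o)` it reaches
  -- every pair `(b, o)`, and then, with the other endpoint held, every pair.
  have step : ∀ {k : ℝ} b c d, b ≠ d → dist (y b) (y d) = k * dist (x b) (x d) →
      dist (y c) (y d) = k * dist (x c) (x d) := fun {k} b c d hbd hk => by
    by_cases hcd : c = d
    · rw [hcd, dist_self, dist_self, mul_zero]
    by_cases hbc : b = c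
    · rw [← hbc, hk]
    have h1 := h b c d hbc hbd hcd
    rw [div_eq_div_iff (px hbd).ne' (py hbd).ne', hk] at h1
    have := px hbd
    apply mul_right_cancel₀ this.ne'
    linarith
  refine ⟨dist (y e) (y o) / dist (x e) (x o), div_pos (py he) (px he), ?_⟩
  have h1 : ∀ b, dist (y b) (y o) = dist (y e) (y o) / dist (x e) (x o) * dist (x b) (x o) :=
    fun b => step e b o he (div_mul_cancel₀ _ (px he).ne').symm
  intro b c
  by_cases hc : c = o
  · rw [hc, h1]
  · refine step o b c (Ne.symm hc) ?_
    rw [dist_comm, h1, dist_comm (x o)]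

/-- Two families containing `∞` and `0` at the same indices, with equal absolute cross-ratios,
are related by a Möbius transformation. -/
theorem exists_mobius_of_normalized {A : Type*} {q q' : A → Ext N} (hq : Function.Injective q)
    (hq' : Function.Injective q') {i o : A} (hi : q i = ∞) (hi' : q' i = ∞)
    (ho : q o = (0 : E N)) (ho' : q' o = (0 : E N))
    (h : ∀ α β γ δ : A, α ≠ β → α ≠ γ → α ≠ δ → β ≠ γ → β ≠ δ → γ ≠ δ →
      absCrossRatio (q α) (q β) (q γ) (q δ) = absCrossRatio (q' α) (q' β) (q' γ) (q' δ)) :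
    ∃ f ∈ mobiusGroup N, ∀ α, f (q α) = q' α := by
  have fin : ∀ {r : A → Ext N}, Function.Injective r → r i = ∞ →
      ∀ α : {α // α ≠ i}, ∃ x : E N, (x : Ext N) = r α := fun hr hri α =>
    OnePoint.ne_infty_iff_exists.1 fun hα => α.2 (hr (hα.trans hri.symm))
  choose x hx using fin hq hi
  choose y hy using fin hq' hi'
  have hoi : o ≠ i := fun hh => OnePoint.coe_ne_infty (0 : E N) (by rw [← ho, hh, hi])
  have xinj : Function.Injective x := fun a b hab =>
    Subtype.ext (hq (by rw [← hx, ← hx, hab]))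
  have yinj : Function.Injective y := fun a b hab =>
    Subtype.ext (hq' (by rw [← hy, ← hy, hab]))
  -- With first index `i`, the cross-ratio is `|c - d| / |b - d|`.
  obtain ⟨k, hk, hxy⟩ := exists_dist_eq_mul x y xinj yinj (fun b c d hbc hbd hcd => by
    have h1 := h i b c d b.2.symm c.2.symm d.2.symm (Subtype.coe_ne_coe.2 hbc)
      (Subtype.coe_ne_coe.2 hbd) (Subtype.coe_ne_coe.2 hcd)
    simpa only [absCrossRatio, hi, hi', ← hx, ← hy, factor_infty_left, factor_coe, one_mul]
      using h1) ⟨o, hoi⟩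
  have x0 : x ⟨o, hoi⟩ = 0 := OnePoint.coe_injective ((hx _).trans ho)
  have y0 : y ⟨o, hoi⟩ = 0 := OnePoint.coe_injective ((hy _).trans ho')
  have hdist : ∀ a b, dist (k • x a) (k • x b) = dist (y a) (y b) := fun a b => by
    rw [dist_smul₀, Real.norm_of_nonneg hk.le, hxy]
  obtain ⟨φ, hφ⟩ := exists_linearIsometryEquiv (fun a => k • x a) y (fun a => by
    simpa only [x0, y0, smul_zero, dist_zero_right] using hdist a ⟨o, hoi⟩) hdist
  obtain ⟨f, hf, hf1, hf2⟩ := exists_mobius_linearIsometryEquiv φ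
  obtain ⟨g, hg, hg1, hg2⟩ := exists_mobius_smul (N := N) hk
  refine ⟨f * g, mul_mem hf hg, fun α => ?_⟩
  rw [Equiv.Perm.mul_apply]
  by_cases hα : α = i
  · rw [hα, hi, hg1, hf1, hi']
  · rw [← hx ⟨α, hα⟩, ← hy ⟨α, hα⟩, hg2, hf2, hφ]

end MobiusSpace

open MobiusSpace in
theorem theorem2 {A : Type*} (N : ℕ)
    (p p' : A → OnePoint (EuclideanSpace ℝ (Fin N)))
    (hp : Function.Injective p) (hp' : Function.Injective p') :
    (∃ f ∈ MobiusSpace.mobiusGroup N, ∀ α : A, f (p α) = p' α) ↔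
      ∀ α β γ δ : A, α ≠ β → α ≠ γ → α ≠ δ → β ≠ γ → β ≠ δ → γ ≠ δ →
        MobiusSpace.absCrossRatio (p α) (p β) (p γ) (p δ) =
          MobiusSpace.absCrossRatio (p' α) (p' β) (p' γ) (p' δ) := by
  constructor
  · rintro ⟨f, hf, h⟩ α β γ δ hαβ hαγ - - hβδ hγδ
    rw [← h, ← h, ← h, ← h, absCrossRatio_map hf (hp.ne hαβ) (hp.ne hαγ) (hp.ne hβδ) (hp.ne hγδ)]
  · intro h
    -- With fewer than two indices there is no second point to place at `0`; transitivity through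
    -- `∞` suffices.
    rcases subsingleton_or_nontrivial A with hA | hA
    · rcases isEmpty_or_nonempty A with hA' | ⟨⟨i⟩⟩
      · exact ⟨1, one_mem _, fun α => hA'.elim α⟩
      obtain ⟨g, hg, hgi⟩ := exists_mobius_apply_eq_infty (p i)
      obtain ⟨g', hg', hgi'⟩ := exists_mobius_apply_eq_infty (p' i)
      refine ⟨g'⁻¹ * g, mul_mem (inv_mem hg') hg, fun α => ?_⟩
      rw [Subsingleton.elim α i, Equiv.Perm.mul_apply, hgi, Equiv.Perm.inv_eq_iff_eq, hgi']
    · obtain ⟨i, o, hio⟩ := exists_pair_ne A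
      obtain ⟨g, hg, hgi, hgo⟩ := exists_mobius_normalize (hp.ne hio)
      obtain ⟨g', hg', hgi', hgo'⟩ := exists_mobius_normalize (hp'.ne hio)
      obtain ⟨f, hf, hfp⟩ := exists_mobius_of_normalized (g.injective.comp hp)
        (g'.injective.comp hp') hgi hgi' hgo hgo' (fun α β γ δ hαβ hαγ hαδ hβγ hβδ hγδ => by
          simp only [Function.comp_apply]
          rw [absCrossRatio_map hg (hp.ne hαβ) (hp.ne hαγ) (hp.ne hβδ) (hp.ne hγδ),
            absCrossRatio_map hg' (hp'.ne hαβ) (hp'.ne hαγ) (hp'.ne hβδ) (hp'.ne hγδ),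
            h α β γ δ hαβ hαγ hαδ hβγ hβδ hγδ])
      refine ⟨g'⁻¹ * (f * g), mul_mem (inv_mem hg') (mul_mem hf hg), fun α => ?_⟩
      rw [Equiv.Perm.mul_apply, Equiv.Perm.inv_eq_iff_eq]
      exact hfp α
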